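/- Let $C$ be a triangulated category with all small coproducts. Terminology: for a class $S$ of objects and $i\in\mathbb Z$, $S[i]=\{X[i]: X\in S\}$ (classes are taken up to isomorphism), $S^\perp=\{Y: C(X,Y)=0\ \forall X\in S\}$ and ${}^\perp S=\{Y: C(Y,X)=0\ \forall X\in S\}$. A morphism $h$ is $S$-null if $C(Q,h)=0$ for all $Q\in S$; $S$ is (countably) perfect if every coproduct of a (countable) family of $S$-null morphisms is $S$-null. A homotopy colimit of $Y_0\xrightarrow{f_0}Y_1\xrightarrow{f_1}\cdots$ is a cone of $\mathrm{id}-\mathrm{shift}:\coprod Y_i\to\coprod Y_i$. The big hull of $S$ is the class of all retracts of homotopy colimits of sequences such that $Y_0$ and all cones of the $f_i$ are coproducts of (small) families of objects of $S$. The strong extension-closure of $S$ is the smallest class that contains $S$ and $0$, is closed with respect to retracts and small coproducts, and contains every homotopy colimit of every sequence such that $Y_0$ and all cones of the $f_i$ belong to the class. A weight structure $w=(C_{w\le 0},C_{w\ge 0})$ on $C$ is a couple of retraction-closed classes of objects such that $C_{w\le0}\subset C_{w\le0}[1]$, $C_{w\ge0}[1]\subset C_{w\ge0}$, $C(X,Y)=0$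 for all $X\in C_{w\le0}$, $Y\in C_{w\ge0}[1]$, and every object $M$ lies in a distinguished triangle $A\to M\to B\to A[1]$ with $A\in C_{w\le0}$, $B\in C_{w\ge0}[1]$. It is (countably) smashing if $C_{w\ge0}$ is closed with respect to small (countable) coproducts of $C$; its heart is the full subcategory with the class of objects $C_{w=0}=C_{w\le0}\cap C_{w\ge0}$; it is generated by $S$ if $C_{w\ge0}=(\bigcup_{i>0}S[-i])^\perp$. The localizing subcategory of $C$ generated by $S$ is the smallest strictly full triangulated subcategory that contains $S$ and is closed with respect to the small coproducts of $C$. **Theorem.** Let $\mathcal P$ be a countably perfect (small) set of objects of $C$, and put $\mathcal P'=\bigcup_{i\le0}\mathcal P[i]$. 1. Let $L$ be the big hull of $\mathcal P'$ and $R=\mathcal P'^\perp[-1]$. Then $w=(L,R)$ is a countably smashing weight structure on $C$, and $L$ equals the strong extension-closure of $\mathcal P'$. Moreover, $R=\bigcap_{i<0}(\mathcal P^\perp[i])$ and $L=({}^\perp R)[1]$. 2. Let $C'$ be the localizing subcategory of $C$ generated by $\mathcal P$ and $O=(\bigcup_{i\in\mathbb Z}\mathcal P[i])^\perp$ (the orthogonal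 being taken in $C$). Then $\mathcal P$ generates a weight structure $w'$ on $C'$; we have $C'_{w'\le0}=L$, the hearts of $w'$ and $w$ coincide (that is, $C'_{w'=0}=C_{w=0}$), and $R$ is the class of all $M\in C$ that lie in a distinguished triangle $A\to M\to B\to A[1]$ with $A\in C'_{w'\ge0}$ and $B\in O$. 3. If $\mathcal P$ is perfect then $w$ is smashing, and there exists $G\in C_{w=0}$ such that every object of $C_{w=0}$ is a retract of a coproduct of copies of $G$. -/

import Mathlib

open CategoryTheory CategoryTheory.Limits CategoryTheory.Pretriangulated

universe v u

namespace PerfWeight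

/-! ### Translations of classes of objects -/

section Shift

variable {C : Type u} [Category.{v} C] [HasShift C ℤ]

/-- The class `P[i]`: objects isomorphic to `Y⟦i⟧` for some `Y` in `P`. -/
def translate (P : ObjectProperty C) (i : ℤ) : ObjectProperty C :=
  fun X => ∃ Y : C, P Y ∧ Nonempty (X ≅ Y⟦i⟧)

/-- The class `⋃_{i ∈ I} P[i]`. -/
def translates (P : ObjectProperty C) (I : Set ℤ) : ObjectProperty C :=
  fun X => ∃ i ∈ I, translate P i X

end Shift

/-! ### Coproducts and perfect classes -/

section Coproducts

variable {C : Type u} [Category.{v} C]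

/-- `P` is closed with respect to those coproducts of `C` that are indexed by sets
(types in the universe `v` of the morphism sets). -/
def IsSmashingClass (P : ObjectProperty C) : Prop :=
  ∀ J : Type v, P.IsClosedUnderColimitsOfShape (Discrete J)

/-- `P` is closed with respect to countable coproducts of `C`. -/
def IsCountablySmashingClass (P : ObjectProperty C) : Prop :=
  ∀ (J : Type) [Countable J], P.IsClosedUnderColimitsOfShape (Discrete J)

/-- The class of all coproducts of families of objects of `P`
(the closure of `P` with respect to coproducts). -/
def coproductsOf (P : ObjectProperty C) : ObjectProperty C :=
  fun X => ∃ J : Type v, P.colimitsOfShape (Discrete J) X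

/-- A morphism `h` is `P`-null if `Hom(Q, h) = 0` for every `Q` in `P`. -/
def nullMorphisms [HasZeroMorphisms C] (P : ObjectProperty C) : MorphismProperty C :=
  fun X _ h => ∀ ⦃Q : C⦄, P Q → ∀ g : Q ⟶ X, g ≫ h = 0

/-- `P` is perfect if the coproduct of any family of `P`-null morphisms is `P`-null. -/
def IsPerfect [HasZeroMorphisms C] (P : ObjectProperty C) : Prop :=
  ∀ J : Type v, (nullMorphisms P).IsStableUnderCoproductsOfShape J

/-- `P` is countably perfect if the coproduct of any countable family of `P`-null morphisms
is `P`-null. -/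
def IsCountablyPerfect [HasZeroMorphisms C] (P : ObjectProperty C) : Prop :=
  ∀ (J : Type) [Countable J], (nullMorphisms P).IsStableUnderCoproductsOfShape J

end Coproducts

section Triangulated

variable {C : Type u} [Category.{v} C] [HasZeroObject C] [HasShift C ℤ] [Preadditive C]
  [∀ n : ℤ, (shiftFunctor C n).Additive] [Pretriangulated C]

/-! ### Homotopy colimits and hulls -/

/-- `Z` is a cone of `f`. -/
def IsCone {X Y : C} (f : X ⟶ Y) (Z : C) : Prop :=
  ∃ (g : Y ⟶ Z) (h : Z ⟶ X⟦(1 : ℤ)⟧), Triangle.mk f g h ∈ distTriang C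

/-- The endomorphism `id - shift` of the coproduct `D` of a sequence
`Y 0 ⟶ Y 1 ⟶ Y 2 ⟶ ⋯`: its restriction to `Y i` is the inclusion of `Y i`
minus the composite `Y i ⟶ Y (i + 1) ⟶ D`. -/
def telescope {Y : ℕ → C} (f : ∀ i, Y i ⟶ Y (i + 1)) {D : Cofan Y} (hD : IsColimit D) :
    D.pt ⟶ D.pt :=
  Cofan.IsColimit.desc hD (fun i => D.inj i - f i ≫ D.inj (i + 1))

/-- `X` is a homotopy colimit of the sequence `Y 0 ⟶ Y 1 ⟶ Y 2 ⟶ ⋯`. -/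
def IsHocolim {Y : ℕ → C} (f : ∀ i, Y i ⟶ Y (i + 1)) (X : C) : Prop :=
  ∃ (D : Cofan Y) (hD : IsColimit D), IsCone (telescope f hD) X

/-- The homotopy colimits of sequences `Y 0 ⟶ Y 1 ⟶ Y 2 ⟶ ⋯` such that `Y 0` and
the cones of all the connecting morphisms belong to `Q`. -/
def hocolimsOf (Q : ObjectProperty C) : ObjectProperty C :=
  fun X => ∃ (Y : ℕ → C) (f : ∀ i, Y i ⟶ Y (i + 1)),
    Q (Y 0) ∧ (∀ i, ∃ Z, IsCone (f i) Z ∧ Q Z) ∧ IsHocolim f X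

/-- `Q` is strongly extension-closed. -/
def IsStronglyExtensionClosed (Q : ObjectProperty C) : Prop :=
  Q.ContainsZero ∧ hocolimsOf Q ≤ Q

/-- The strong extension-closure of `P`: the smallest strongly extension-closed
retraction-closed class that contains `P` and is closed with respect to coproducts. -/
def strongExtensionClosure (P : ObjectProperty C) : ObjectProperty C :=
  fun X => ∀ Q : ObjectProperty C, IsStronglyExtensionClosed Q → Q.IsStableUnderRetracts →
    IsSmashingClass Q → P ≤ Q → Q X

/-- The big hull of `P`: all retracts of homotopy colimits of sequences whose zeroth object and
whose cones are coproducts of families of objects of `P`. -/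
def bigHull (P : ObjectProperty C) : ObjectProperty C :=
  (hocolimsOf (coproductsOf P)).retractClosure

/-! ### Weight structures -/

/-- The couple `(L, R)`, with `L = C_{w ≤ 0}` and `R = C_{w ≥ 0}`, is a weight structure
(in the homological convention). -/
structure IsWeightStructure (L R : ObjectProperty C) : Prop where
  retract_le : L.IsStableUnderRetracts
  retract_ge : R.IsStableUnderRetracts
  le_shift : L ≤ translate L 1
  shift_ge : translate R 1 ≤ R
  orthogonal : ∀ ⦃X Y : C⦄, L X → translate R 1 Y → ∀ f : X ⟶ Y, f = 0
  exists_decomposition : ∀ M : C, ∃ (A B : C) (a : A ⟶ M) (b : M ⟶ B) (d : B ⟶ A⟦(1 : ℤ)⟧),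
    Triangle.mk a b d ∈ distTriang C ∧ L A ∧ translate R 1 B

/-- A weight structure with `C_{w ≥ 0} = R` is generated by `P` if
`R = (⋃_{i > 0} P[-i])^⊥`. -/
def IsGeneratedBy (R P : ObjectProperty C) : Prop :=
  R = (translates P (Set.Iio 0)).rightOrthogonal

/-! ### Localizing subcategories -/

/-- `Q` is the class of objects of a strictly full triangulated subcategory of `C` that is closed
with respect to the coproducts of `C`. -/
structure IsLocalizing (Q : ObjectProperty C) : Prop where
  triangulated : Q.IsTriangulated
  strict : Q.IsClosedUnderIsomorphisms
  coproducts : IsSmashingClass Q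

/-- The class of objects of the localizing subcategory of `C` generated by `P`. -/
def localizingClosure (P : ObjectProperty C) : ObjectProperty C :=
  fun X => ∀ Q : ObjectProperty C, IsLocalizing Q → P ≤ Q → Q X

/-- This makes the full subcategory on `localizingClosure P` a triangulated category. -/
instance localizingClosure_isTriangulated (P : ObjectProperty C) :
    (localizingClosure P).IsTriangulated where
  exists_zero := ⟨_, isZero_zero C, fun Q hQ _ => by
    have := hQ.triangulated
    have := hQ.strict
    exact Q.prop_zero⟩
  isStableUnderShiftBy n := ⟨fun X hX Q hQ h => by
    have := hQ.triangulated
    exact Q.le_shift n _ (hX Q hQ h)⟩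
  ext₂' T hT h₁ h₃ := ObjectProperty.le_isoClosure _ _ fun Q hQ h => by
    have := hQ.triangulated
    have := hQ.strict
    exact Q.ext_of_isTriangulatedClosed₂ T hT (h₁ Q hQ h) (h₃ Q hQ h)

end Triangulated

end PerfWeight

/-! Write `S` for the negative translates of `P` (degree 0 included). Everything rests on one
construction: a tower of objects over a given `M`. It starts with the coproduct of all morphisms
from `S` to `M`. Each step attaches a coproduct of objects of `S` in order to kill the morphisms
from `S[-1]` that vanish in `M`. Let `A` be the homotopy colimit. Countable perfectness makes `A ⟶
M` surjective on morphisms from `S` and injective on those from `S[-1]`, so its cone is in `S^⊥`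
(`exists_decomposition_of_approximations`, `exists_distTriang_hocolimsOf`).

Conversely, any class `^⊥R` contains the homotopy colimits of its sequences, because the relevant
`lim¹` vanishes (`hocolimsOf_leftOrthogonal_le`). Hence big hull ⊆ strong closure ⊆ `^⊥(S^⊥)`. An
object of the last class has zero map to its cone in `S^⊥`, so it is a retract of its approximation;
the three classes coincide and `w` is a weight structure.

Localizing classes are closed under all these operations (retracts by an Eilenberg swindle), so `L`
lies in the localizing subcategory and `w` restricts to it. The same construction for all translates
of `P` gives the decomposition of `R`.

If `P` is perfect, then `S^⊥` is closed under coproducts. The coproduct of weak reflections into the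
heart of the objects of `P` then generates the heart up to copowers and retracts
(`IsWeightStructure.exists_heart_generator`). -/

namespace PerfWeight

section Shift

variable {C : Type u} [Category.{v} C] [HasShift C ℤ]

instance (S : ObjectProperty C) (i : ℤ) : (translate S i).IsClosedUnderIsomorphisms where
  of_iso e := fun ⟨Y, hY, ⟨e'⟩⟩ => ⟨Y, hY, ⟨e.symm ≪≫ e'⟩⟩

instance (S : ObjectProperty C) (I : Set ℤ) :
    (translates S I).IsClosedUnderIsomorphisms where
  of_iso e := fun ⟨i, hi, h⟩ => ⟨i, hi, (translate S i).prop_of_iso e h⟩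

lemma translate_iff_of_add_eq_zero (S : ObjectProperty C) [S.IsClosedUnderIsomorphisms]
    {i j : ℤ} (h : i + j = 0) (X : C) : translate S i X ↔ S (X⟦j⟧) := by
  constructor
  · rintro ⟨Y, hY, ⟨e⟩⟩
    exact S.prop_of_iso ((shiftFunctor C j).mapIso e ≪≫
      (shiftFunctorCompIsoId C i j h).app Y).symm hY
  · intro hX
    exact ⟨_, hX, ⟨((shiftFunctorCompIsoId C j i (by omega)).app X).symm⟩⟩

/-- A morphism into a translate is, up to an isomorphism of the source, a translated morphism. -/
lemma exists_eq_comp_map_shift {Q X : C} (i : ℤ) (x : Q ⟶ X⟦i⟧) :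
    ∃ x' : Q⟦-i⟧ ⟶ X, x = (shiftNegShift Q i).inv ≫ x'⟦i⟧' := by
  obtain ⟨x', hx'⟩ := (shiftFunctor C i).map_surjective ((shiftNegShift Q i).hom ≫ x)
  exact ⟨x', by simp [hx']⟩

lemma eq_zero_of_shift_map_eq_zero [Preadditive C] [∀ n : ℤ, (shiftFunctor C n).Additive]
    {X Y : C} (i : ℤ) (f : X ⟶ Y) (h : f⟦i⟧' = 0) : f = 0 :=
  (shiftFunctor C i).map_injective (by simpa using h)

end Shift

/-! ### Null morphisms and perfectness under translation -/

section Null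

variable {C : Type u} [Category.{v} C] [HasZeroMorphisms C]

lemma nullMorphisms_id_iff (S : ObjectProperty C) (X : C) :
    nullMorphisms S (𝟙 X) ↔ S.rightOrthogonal X :=
  ⟨fun h Q f hQ => by simpa using h hQ f, fun h Q hQ f => by simpa using h f hQ⟩

/-- An object is orthogonal to `S` exactly when its identity is `S`-null, and a coproduct of
identities is an identity. -/
lemma isClosedUnderColimitsOfShape_rightOrthogonal (S : ObjectProperty C) (J : Type*)
    [(nullMorphisms S).IsStableUnderCoproductsOfShape J] :
    S.rightOrthogonal.IsClosedUnderColimitsOfShape (Discrete J) where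
  colimitsOfShape_le := by
    rintro X ⟨h⟩
    rw [← nullMorphisms_id_iff]
    exact MorphismProperty.IsStableUnderColimitsOfShape.condition _ _ _ _ h.isColimit h.isColimit
      (𝟙 _) (fun j => (nullMorphisms_id_iff S _).2 (h.prop_diag_obj j)) _ (by simp)

lemma nullMorphisms_sigmaMap (S : ObjectProperty C) {J : Type*}
    [(nullMorphisms S).IsStableUnderCoproductsOfShape J] {X Y : J → C}
    [HasCoproduct X] [HasCoproduct Y] (f : ∀ j, X j ⟶ Y j) (hf : ∀ j, nullMorphisms S (f j)) :
    nullMorphisms S (Limits.Sigma.map f) :=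
  MorphismProperty.colimMap _ (fun j => hf j.as)

end Null

section Perfect

variable {C : Type u} [Category.{v} C] [HasShift C ℤ] [Preadditive C]

lemma nullMorphisms_translates_iff (S : ObjectProperty C) (I : Set ℤ)
    {X Y : C} (h : X ⟶ Y) :
    nullMorphisms (translates S I) h ↔ ∀ i ∈ I, nullMorphisms (translate S i) h :=
  ⟨fun H i hi _ hQ g => H ⟨i, hi, hQ⟩ g, fun H _ ⟨i, hi, hQ⟩ g => H i hi hQ g⟩

variable [∀ n : ℤ, (shiftFunctor C n).Additive]

lemma nullMorphisms_translate_iff (S : ObjectProperty C) {i j : ℤ} (hij : i + j = 0)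
    {X Y : C} (h : X ⟶ Y) :
    nullMorphisms (translate S i) h ↔ nullMorphisms S (h⟦j⟧') := by
  constructor
  · intro H Q hQ g
    have e := (shiftFunctorCompIsoId C i j hij).app Q
    obtain ⟨g', hg'⟩ := (shiftFunctor C j).map_surjective (e.hom ≫ g)
    have h0 := H ⟨Q, hQ, ⟨Iso.refl _⟩⟩ g'
    rw [← cancel_epi e.hom, ← Category.assoc, ← hg', ← Functor.map_comp, h0]
    simp
  · rintro H Q ⟨Q', hQ', ⟨e⟩⟩ g
    apply eq_zero_of_shift_map_eq_zero j
    let e' := (shiftFunctor C j).mapIso e ≪≫ (shiftFunctorCompIsoId C i j hij).app Q'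
    have h0 := H hQ' (e'.inv ≫ g⟦j⟧')
    rw [Category.assoc, ← Functor.map_comp] at h0
    rw [← cancel_epi e'.inv, h0, comp_zero]

lemma isStableUnderCoproductsOfShape_nullMorphisms_translate (S : ObjectProperty C) (i : ℤ)
    (J : Type*) [(nullMorphisms S).IsStableUnderCoproductsOfShape J] :
    (nullMorphisms (translate S i)).IsStableUnderCoproductsOfShape J where
  condition X₁ X₂ c₁ c₂ h₁ h₂ f hf φ hφ := by
    have hij : i + (-i) = 0 := add_neg_cancel i
    rw [nullMorphisms_translate_iff S hij]
    refine MorphismProperty.IsStableUnderColimitsOfShape.condition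
      (X₁ ⋙ shiftFunctor C (-i)) (X₂ ⋙ shiftFunctor C (-i)) _ _
      (isColimitOfPreserves (shiftFunctor C (-i)) h₁)
      (isColimitOfPreserves (shiftFunctor C (-i)) h₂)
      (Functor.whiskerRight f (shiftFunctor C (-i)))
      (fun j => (nullMorphisms_translate_iff S hij _).1 (hf j)) _ (fun j => ?_)
    simp only [Functor.mapCocone_ι_app, Functor.whiskerRight_app, ← Functor.map_comp, hφ]

lemma isStableUnderCoproductsOfShape_nullMorphisms_translates (S : ObjectProperty C) (I : Set ℤ)
    (J : Type*) [(nullMorphisms S).IsStableUnderCoproductsOfShape J] :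
    (nullMorphisms (translates S I)).IsStableUnderCoproductsOfShape J where
  condition X₁ X₂ c₁ c₂ h₁ h₂ f hf φ hφ := by
    rw [nullMorphisms_translates_iff]
    intro i hi
    have := isStableUnderCoproductsOfShape_nullMorphisms_translate S i J
    exact MorphismProperty.IsStableUnderColimitsOfShape.condition _ _ _ _ h₁ h₂ f
      (fun j => (nullMorphisms_translates_iff S I _).1 (hf j) i hi) φ hφ

lemma IsCountablyPerfect.translate {S : ObjectProperty C} (hS : IsCountablyPerfect S) (i : ℤ) :
    IsCountablyPerfect (translate S i) := fun J _ => by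
  have := hS J
  exact isStableUnderCoproductsOfShape_nullMorphisms_translate S i J

lemma IsCountablyPerfect.translates {S : ObjectProperty C} (hS : IsCountablyPerfect S)
    (I : Set ℤ) : IsCountablyPerfect (translates S I) := fun J _ => by
  have := hS J
  exact isStableUnderCoproductsOfShape_nullMorphisms_translates S I J

lemma IsPerfect.translates {S : ObjectProperty C} (hS : IsPerfect S)
    (I : Set ℤ) : IsPerfect (translates S I) := fun J => by
  have := hS J
  exact isStableUnderCoproductsOfShape_nullMorphisms_translates S I J

end Perfect

/-! ### Telescopes and homotopy colimits of approximations -/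

section Triangulated

variable {C : Type u} [Category.{v} C] [HasZeroObject C] [HasShift C ℤ] [Preadditive C]
  [∀ n : ℤ, (shiftFunctor C n).Additive] [Pretriangulated C]

/-- Weak exactness of a coproduct of distinguished triangles. -/
lemma exists_lift_sigmaMap {J : Type*} {X Y Z : J → C} [HasCoproduct X] [HasCoproduct Y]
    [HasCoproduct Z] (f : ∀ j, X j ⟶ Y j) (g : ∀ j, Y j ⟶ Z j) (h : ∀ j, Z j ⟶ (X j)⟦(1 : ℤ)⟧)
    (hT : ∀ j, Triangle.mk (f j) (g j) (h j) ∈ distTriang C)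
    {Q : C} (z : Q ⟶ ∐ Y) (hz : z ≫ Limits.Sigma.map g = 0) :
    ∃ w : Q ⟶ ∐ X, z = w ≫ Limits.Sigma.map f := by
  obtain ⟨W, G, d, hW⟩ := distinguished_cocone_triangle (Limits.Sigma.map f)
  -- The coproduct triangle need not be known to be distinguished: it suffices that the map to the
  -- cone of the coproduct of the `f j` factors through the coproduct of the `g j`.
  have (j : J) : ∃ c : Z j ⟶ W, g j ≫ c = Sigma.ι Y j ≫ G := by
    obtain ⟨c, hc, -⟩ := complete_distinguished_triangle_morphism _ _ (hT j) hW
      (Sigma.ι X j) (Sigma.ι Y j) (Sigma.ι_map f j).symm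
    exact ⟨c, hc⟩
  choose c hc using this
  have hG : G = Limits.Sigma.map g ≫ Sigma.desc c := Sigma.hom_ext _ _ (by simp [hc])
  exact Triangle.coyoneda_exact₂ _ hW z
    (show z ≫ G = 0 by rw [hG, reassoc_of% hz, zero_comp])

end Triangulated

section Telescope

variable {C : Type u} [Category.{v} C] [Preadditive C]

lemma inj_telescope {Y : ℕ → C} (f : ∀ i, Y i ⟶ Y (i + 1)) {D : Cofan Y} (hD : IsColimit D)
    (i : ℕ) : D.inj i ≫ telescope f hD = D.inj i - f i ≫ D.inj (i + 1) :=
  Cofan.IsColimit.fac hD _ i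

variable [HasColimitsOfShape (Discrete ℕ) C]

/-- The morphism `id - shift` on the chosen coproduct of a sequence. -/
noncomputable def sigmaTelescope {Y : ℕ → C} (f : ∀ i, Y i ⟶ Y (i + 1)) : ∐ Y ⟶ ∐ Y :=
  telescope f (coproductIsCoproduct Y)

lemma ι_sigmaTelescope {Y : ℕ → C} (f : ∀ i, Y i ⟶ Y (i + 1)) (i : ℕ) :
    Sigma.ι Y i ≫ sigmaTelescope f =
      Sigma.ι Y i - f i ≫ Sigma.ι Y (i + 1) :=
  inj_telescope f (coproductIsCoproduct Y) i

/-- For a constant sequence `id - shift` is a split monomorphism whose cokernel is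
the codiagonal. -/
lemma exists_retraction_telescope_const (M : C) :
    ∃ r : (∐ fun _ : ℕ => M) ⟶ ∐ fun _ : ℕ => M,
      sigmaTelescope (fun _ : ℕ => 𝟙 M) ≫ r = 𝟙 _ ∧
      r ≫ sigmaTelescope (fun _ : ℕ => 𝟙 M) =
        𝟙 _ - Sigma.desc (fun _ => 𝟙 M) ≫ Sigma.ι (fun _ : ℕ => M) 0 := by
  let j : ℕ → (M ⟶ ∐ fun _ : ℕ => M) := fun k => Sigma.ι (fun _ : ℕ => M) k
  -- Minus the `k`-th partial sum of the inclusions; composing with `id - shift` telescopes.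
  refine ⟨Sigma.desc fun k => -∑ i ∈ Finset.range k, j i, Sigma.hom_ext _ _ fun k => ?_,
    Sigma.hom_ext _ _ fun k => ?_⟩
  · rw [reassoc_of% ι_sigmaTelescope (fun _ : ℕ => 𝟙 M)]
    simp [Preadditive.sub_comp, Finset.sum_range_succ, j]
  · have h (i : ℕ) : j i ≫ sigmaTelescope (fun _ : ℕ => 𝟙 M) =
        j i - j (i + 1) := by
      simpa using ι_sigmaTelescope (fun _ => 𝟙 M) i
    rw [Sigma.ι_desc_assoc, Preadditive.neg_comp, Preadditive.sum_comp]
    simp only [h, Finset.sum_range_sub', Preadditive.comp_sub, Sigma.ι_desc_assoc,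
      Category.id_comp, Category.comp_id]
    simp [j]

section

variable {M : C} {Y : ℕ → C} {f : ∀ k, Y k ⟶ Y (k + 1)} {φ : ∀ k, Y k ⟶ M}

lemma sigmaTelescope_comp_sigmaMap (hf : ∀ k, f k ≫ φ (k + 1) = φ k) :
    sigmaTelescope f ≫ Limits.Sigma.map φ =
      Limits.Sigma.map φ ≫ sigmaTelescope (fun _ : ℕ => 𝟙 M) := by
  refine Sigma.hom_ext _ _ fun k => ?_
  rw [reassoc_of% ι_sigmaTelescope f, Sigma.ι_map_assoc, ι_sigmaTelescope]
  simp [Preadditive.sub_comp, reassoc_of% hf]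

variable [HasZeroObject C] [HasShift C ℤ] [∀ n : ℤ, (shiftFunctor C n).Additive]
  [Pretriangulated C] {S : ObjectProperty C}

/-- If `S` is countably perfect and the connecting morphisms kill the morphisms from `S`
that vanish in `M`, then `id - shift` is the identity on the morphisms from `S` to the coproduct
that vanish in the coproduct of copies of `M`. -/
lemma comp_sigmaTelescope_of_comp_sigmaMap_eq_zero
    [(nullMorphisms S).IsStableUnderCoproductsOfShape ℕ]
    (hφ : ∀ k ⦃Q : C⦄, S Q → ∀ x : Q ⟶ Y k, x ≫ φ k = 0 → x ≫ f k = 0)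
    {Q : C} (hQ : S Q) (x : Q ⟶ ∐ Y) (hx : x ≫ Limits.Sigma.map φ = 0) :
    x ≫ sigmaTelescope f = x := by
  choose F i d hT using fun k => distinguished_cocone_triangle₁ (φ k)
  obtain ⟨w, rfl⟩ := exists_lift_sigmaMap i φ d hT x hx
  -- A morphism from `S` through the fibre of `φ k` vanishes in `M`, so `f k` kills it. Stability
  -- under countable coproducts then makes the shift vanish on `x`.
  have h0 : nullMorphisms S (Limits.Sigma.map fun k => i k ≫ f k) :=
    nullMorphisms_sigmaMap S _ fun k Q hQ g => by
      have : i k ≫ φ k = 0 := comp_distTriang_mor_zero₁₂ _ (hT k)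
      rw [← Category.assoc]
      exact hφ k hQ _ (by rw [Category.assoc, this, comp_zero])
  have h1 : Limits.Sigma.map i ≫ sigmaTelescope f =
      Limits.Sigma.map i - Limits.Sigma.map (fun k => i k ≫ f k) ≫
        Sigma.desc (fun k => Sigma.ι Y (k + 1)) := by
    refine Sigma.hom_ext _ _ fun k => ?_
    simp [ι_sigmaTelescope, Preadditive.comp_sub]
  rw [Category.assoc, h1, Preadditive.comp_sub, reassoc_of% h0 hQ w, zero_comp, sub_zero]

/-- `id - shift` on copies of `M` is a split monomorphism, so `x` already vanishes there; on such
`x` the telescope acts as the identity. -/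
lemma eq_zero_of_comp_sigmaTelescope_eq_zero
    [(nullMorphisms S).IsStableUnderCoproductsOfShape ℕ]
    (hf : ∀ k, f k ≫ φ (k + 1) = φ k)
    (hφ : ∀ k ⦃Q : C⦄, S Q → ∀ x : Q ⟶ Y k, x ≫ φ k = 0 → x ≫ f k = 0)
    {Q : C} (hQ : S Q) (x : Q ⟶ ∐ Y) (hx : x ≫ sigmaTelescope f = 0) :
    x = 0 := by
  obtain ⟨r, hr, -⟩ := exists_retraction_telescope_const M
  rw [← comp_sigmaTelescope_of_comp_sigmaMap_eq_zero hφ hQ x, hx]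
  rw [← Category.comp_id (Limits.Sigma.map φ), ← hr,
    ← reassoc_of% sigmaTelescope_comp_sigmaMap hf, reassoc_of% hx, zero_comp]

/-- Surjectivity on morphisms from a countably perfect class passes to countable coproducts. -/
lemma exists_lift_sigmaMap_of_surjective
    [(nullMorphisms S).IsStableUnderCoproductsOfShape ℕ]
    (hφ : ∀ k ⦃Q : C⦄, S Q → ∀ y : Q ⟶ M, ∃ x : Q ⟶ Y k, x ≫ φ k = y)
    {Q : C} (hQ : S Q) (z : Q ⟶ ∐ fun _ : ℕ => M) :
    ∃ x : Q ⟶ ∐ Y, z = x ≫ Limits.Sigma.map φ := by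
  choose N p d hT using fun k => distinguished_cocone_triangle (φ k)
  have h0 : nullMorphisms S (Limits.Sigma.map p) :=
    nullMorphisms_sigmaMap S _ fun k Q hQ g => by
      obtain ⟨x, rfl⟩ := hφ k hQ g
      have : φ k ≫ p k = 0 := comp_distTriang_mor_zero₁₂ _ (hT k)
      rw [Category.assoc, this, comp_zero]
  exact exists_lift_sigmaMap φ p d hT z (h0 hQ z)

/-- A homotopy colimit of successive approximations of `M` by a countably perfect class `S`
is an approximation of `M` whose cone is orthogonal to `S`. -/
lemma exists_decomposition_of_approximations
    (hS : IsCountablyPerfect S) [S.IsClosedUnderIsomorphisms] (hSs : ∀ Q, S Q → S (Q⟦(-1 : ℤ)⟧))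
    (hf : ∀ k, f k ≫ φ (k + 1) = φ k)
    (hsurj : ∀ k ⦃Q : C⦄, S Q → ∀ y : Q ⟶ M, ∃ x : Q ⟶ Y k, x ≫ φ k = y)
    (hker : ∀ k ⦃Q : C⦄, S (Q⟦(1 : ℤ)⟧) → ∀ x : Q ⟶ Y k, x ≫ φ k = 0 → x ≫ f k = 0) :
    ∃ (A B : C) (a : A ⟶ M) (b : M ⟶ B) (d : B ⟶ A⟦(1 : ℤ)⟧),
      Triangle.mk a b d ∈ distTriang C ∧ IsHocolim f A ∧ S.rightOrthogonal B := by
  let t := sigmaTelescope f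
  obtain ⟨A, p, δ, hA⟩ := distinguished_cocone_triangle t
  have htp : t ≫ p = 0 := comp_distTriang_mor_zero₁₂ _ hA
  obtain ⟨a, ha⟩ : ∃ a : A ⟶ M, Sigma.desc φ = p ≫ a :=
    Triangle.yoneda_exact₂ _ hA (Sigma.desc φ) (Sigma.hom_ext _ _ fun k => by
      change Sigma.ι Y k ≫ sigmaTelescope f ≫ Sigma.desc φ = Sigma.ι Y k ≫ 0
      rw [reassoc_of% ι_sigmaTelescope f]
      simp [Preadditive.sub_comp, hf])
  obtain ⟨B, b, d, hB⟩ := distinguished_cocone_triangle a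
  refine ⟨A, B, a, b, d, hB, ⟨_, _, p, δ, hA⟩, ?_⟩
  have := hS ℕ
  -- Orthogonality of the cone `B` to `S` requires injectivity of `A ⟶ M` one degree lower, on
  -- morphisms from `S[-1]`, which lies in `S`.
  let S' := translate S (-1)
  have hS' (Q : C) : S' Q ↔ S (Q⟦(1 : ℤ)⟧) := translate_iff_of_add_eq_zero S (by simp) Q
  have := hS.translate (-1) ℕ
  have hker' : ∀ k ⦃Q : C⦄, S' Q → ∀ x : Q ⟶ Y k, x ≫ φ k = 0 → x ≫ f k = 0 :=
    fun k Q hQ => hker k ((hS' Q).1 hQ)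
  have hS'S (Q : C) (hQ : S' Q) : S Q :=
    S.prop_of_iso (shiftShiftNeg Q (1 : ℤ)) (hSs _ ((hS' Q).1 hQ))
  have hmono : ∀ ⦃Q : C⦄, S' Q → ∀ c : Q ⟶ A, c ≫ a = 0 → c = 0 := by
    intro Q hQ c hc
    have hδ : c ≫ δ = 0 := by
      obtain ⟨x, hx⟩ := exists_eq_comp_map_shift 1 (c ≫ δ)
      have hδt : δ ≫ t⟦(1 : ℤ)⟧' = 0 := comp_distTriang_mor_zero₃₁ _ hA
      have hx0 : x = 0 := by
        refine eq_zero_of_comp_sigmaTelescope_eq_zero hf hker'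
          ((hS' _).2 (S.prop_of_iso (shiftNegShift Q (1 : ℤ)).symm (hS'S Q hQ))) x ?_
        apply eq_zero_of_shift_map_eq_zero 1
        rw [Functor.map_comp, ← cancel_epi (shiftNegShift Q (1 : ℤ)).inv, ← Category.assoc, ← hx,
          Category.assoc, hδt, comp_zero, comp_zero]
      rw [hx, hx0, Functor.map_zero, comp_zero]
    obtain ⟨y, rfl⟩ : ∃ y : Q ⟶ ∐ Y, c = y ≫ p := Triangle.coyoneda_exact₃ _ hA c hδ
    obtain ⟨r, -, hr⟩ := exists_retraction_telescope_const M
    -- The image of `y` in the copies of `M` has zero codiagonal, so it comes from `id - shift`.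
    -- Lifting its preimage to `x` lets `y` be corrected by `x ≫ t`, which `p` kills, to a morphism
    -- that vanishes in the copies of `M`.
    obtain ⟨x, hx⟩ := exists_lift_sigmaMap_of_surjective hsurj (hS'S Q hQ)
      (y ≫ Limits.Sigma.map φ ≫ r)
    have hfold : Limits.Sigma.map φ ≫ Sigma.desc (fun _ => 𝟙 M) = Sigma.desc φ :=
      Sigma.hom_ext _ _ (by simp)
    have hy : y ≫ Sigma.desc φ = 0 := by rw [ha, ← Category.assoc, hc]
    have h1 : (y - x ≫ t) ≫ Limits.Sigma.map φ = 0 := by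
      rw [Preadditive.sub_comp, Category.assoc, sigmaTelescope_comp_sigmaMap hf, ← reassoc_of% hx, hr,
        Preadditive.comp_sub, Preadditive.comp_sub, reassoc_of% hfold, reassoc_of% hy]
      simp
    have h2 : (y - x ≫ t) ≫ t = y - x ≫ t :=
      comp_sigmaTelescope_of_comp_sigmaMap_eq_zero hker' hQ _ h1
    calc y ≫ p = (y - x ≫ t) ≫ p := by simp [Preadditive.sub_comp, htp]
      _ = ((y - x ≫ t) ≫ t) ≫ p := by rw [h2]
      _ = 0 := by rw [Category.assoc, htp, comp_zero]
  intro Q g hQ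
  have hd : g ≫ d = 0 := by
    obtain ⟨x, hx⟩ := exists_eq_comp_map_shift 1 (g ≫ d)
    have hda : d ≫ a⟦(1 : ℤ)⟧' = 0 := comp_distTriang_mor_zero₃₁ _ hB
    have hx0 : x = 0 := by
      refine hmono ((hS' _).2 (S.prop_of_iso (shiftNegShift Q (1 : ℤ)).symm hQ)) x ?_
      apply eq_zero_of_shift_map_eq_zero 1
      rw [Functor.map_comp, ← cancel_epi (shiftNegShift Q (1 : ℤ)).inv, ← Category.assoc, ← hx,
        Category.assoc, hda, comp_zero, comp_zero]
    rw [hx, hx0, Functor.map_zero, comp_zero]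
  obtain ⟨y, rfl⟩ : ∃ y : Q ⟶ M, g = y ≫ b := Triangle.coyoneda_exact₃ _ hB g hd
  obtain ⟨x, rfl⟩ := hsurj 0 hQ y
  have hab : a ≫ b = 0 := comp_distTriang_mor_zero₁₂ _ hB
  rw [show φ 0 = Sigma.ι Y 0 ≫ p ≫ a by rw [← ha, Sigma.ι_desc]]
  simp [hab]

end

end Telescope

/-! ### Small precovers, orthogonals and hulls -/

section Coproducts

variable {C : Type u} [Category.{v} C]

lemma coproductsOf_sigma {S : ObjectProperty C} {J : Type v} (Y : J → C) [HasCoproduct Y]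
    (hY : ∀ j, S (Y j)) : coproductsOf S (∐ Y) :=
  ⟨J, ⟨{  diag := Discrete.functor Y
          ι := (Cofan.mk (∐ Y) (Sigma.ι Y)).ι
          isColimit := coproductIsCoproduct Y
          prop_diag_obj := fun j => hY j.as }⟩⟩

lemma coproductsOf_le {S T : ObjectProperty C} (hT : IsSmashingClass T) (h : S ≤ T) :
    coproductsOf S ≤ T := fun _ ⟨J, hX⟩ =>
  (hT J).colimitsOfShape_le _ (ObjectProperty.colimitsOfShape_monotone _ h _ hX)

/-- `S` is covered, up to isomorphisms, by a family indexed by a type in the universe of the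
morphisms. -/
def HasSmallSkeleton (S : ObjectProperty C) : Prop :=
  ∃ (ι : Type v) (q : ι → C), (∀ i, S (q i)) ∧ ∀ Q, S Q → ∃ i, Nonempty (Q ≅ q i)

/-- The approximation of the kernel of `k` by a coproduct of objects of `S`. -/
lemma HasSmallSkeleton.exists_precover [HasZeroMorphisms C] [HasCoproducts.{v} C]
    {S : ObjectProperty C} (hS : HasSmallSkeleton S) {Z Z' : C} (k : Z ⟶ Z') :
    ∃ (A : C) (h : A ⟶ Z), coproductsOf S A ∧ h ≫ k = 0 ∧
      ∀ ⦃Q : C⦄, S Q → ∀ x : Q ⟶ Z, x ≫ k = 0 → ∃ s : Q ⟶ A, x = s ≫ h := by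
  obtain ⟨ι, q, hq, hq'⟩ := hS
  let J := Σ i : ι, { x : q i ⟶ Z // x ≫ k = 0 }
  refine ⟨∐ fun j : J => q j.1, Sigma.desc fun j => j.2.1, coproductsOf_sigma _ fun j => hq _,
    Sigma.hom_ext _ _ fun j => by simp [j.2.2], fun Q hQ x hx => ?_⟩
  obtain ⟨i, ⟨e⟩⟩ := hq' Q hQ
  let j : J := ⟨i, e.inv ≫ x, by rw [Category.assoc, hx, comp_zero]⟩
  exact ⟨e.hom ≫ Sigma.ι (fun j : J => q j.1) j, by simp [j]⟩

lemma hasSmallSkeleton_translates [HasShift C ℤ] (P : ObjectProperty C)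
    [ObjectProperty.Small.{v} P] (I : Set ℤ) : HasSmallSkeleton (translates P I) := by
  refine ⟨Shrink.{v} (Subtype P) × ULift.{v} I,
    fun p => ((equivShrink (Subtype P)).symm p.1).1⟦p.2.down.1⟧, fun p =>
      ⟨p.2.down.1, p.2.down.2, _, ((equivShrink (Subtype P)).symm p.1).2, ⟨Iso.refl _⟩⟩, ?_⟩
  rintro Q ⟨i, hi, Y, hY, ⟨e⟩⟩
  exact ⟨⟨equivShrink _ ⟨Y, hY⟩, ⟨⟨i, hi⟩⟩⟩, ⟨e ≪≫ eqToIso (by simp)⟩⟩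

end Coproducts

section Orthogonal

variable {C : Type u} [Category.{v} C] [HasZeroMorphisms C]

instance (R : ObjectProperty C) : R.leftOrthogonal.IsStableUnderRetracts where
  of_retract r hY Z g hZ := by
    rw [← Category.id_comp g, ← r.retract, Category.assoc, hY (r.r ≫ g) hZ, comp_zero]

instance (S : ObjectProperty C) : S.rightOrthogonal.IsStableUnderRetracts where
  of_retract r hY Q g hQ := by
    rw [← Category.comp_id g, ← r.retract, ← Category.assoc, hY (g ≫ r.i) hQ, zero_comp]

instance (R : ObjectProperty C) (J : Type*) [Category* J] :
    R.leftOrthogonal.IsClosedUnderColimitsOfShape J where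
  colimitsOfShape_le := by
    rintro X ⟨h⟩ Z g hZ
    exact h.isColimit.hom_ext fun j => by
      rw [h.prop_diag_obj j (_ ≫ g) hZ, comp_zero]

lemma isSmashingClass_leftOrthogonal (R : ObjectProperty C) :
    IsSmashingClass R.leftOrthogonal := fun _ => inferInstance

lemma le_leftOrthogonal_rightOrthogonal (S : ObjectProperty C) :
    S ≤ S.rightOrthogonal.leftOrthogonal := fun _ hX _ f hY => hY f hX

end Orthogonal

section Triangulated

variable {C : Type u} [Category.{v} C] [HasZeroObject C] [HasShift C ℤ] [Preadditive C]
  [∀ n : ℤ, (shiftFunctor C n).Additive] [Pretriangulated C]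

lemma hocolimsOf_monotone {S T : ObjectProperty C} (h : S ≤ T) : hocolimsOf S ≤ hocolimsOf T :=
  fun _ ⟨Y, f, h₀, hf, hX⟩ =>
    ⟨Y, f, h _ h₀, fun i => (hf i).imp fun _ hZ => ⟨hZ.1, h _ hZ.2⟩, hX⟩

/-- A Mittag-Leffler argument. The cones have no morphisms to `Z`, so restriction along each `f i`
is surjective on morphisms to `Z[-1]`; hence the `lim¹` contribution to the morphisms from the
homotopy colimit to `Z` vanishes. -/
lemma hocolimsOf_leftOrthogonal_le (R : ObjectProperty C) :
    hocolimsOf R.leftOrthogonal ≤ R.leftOrthogonal := by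
  rintro X ⟨Y, f, h₀, hf, D, hD, p, δ, hX⟩ Z g hZ
  choose N hN hN' using hf
  choose a b hT using hN
  have hY (i : ℕ) : R.leftOrthogonal (Y i) := by
    induction i with
    | zero => exact h₀
    | succ i hi => exact ObjectProperty.ext_of_isTriangulatedClosed₂ _ _ (hT i) hi (hN' i)
  let Z' := Z⟦(-1 : ℤ)⟧
  let e : Z'⟦(1 : ℤ)⟧ ≅ Z := shiftNegShift Z (1 : ℤ)
  have hext (i : ℕ) (y : Y i ⟶ Z') : ∃ y' : Y (i + 1) ⟶ Z', f i ≫ y' = y := by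
    obtain ⟨ψ, hψ⟩ : ∃ ψ : (Y (i + 1))⟦(1 : ℤ)⟧ ⟶ Z'⟦(1 : ℤ)⟧, y⟦(1 : ℤ)⟧' = (-(f i)⟦1⟧') ≫ ψ :=
      Triangle.yoneda_exact₃ _ (rot_of_distTriang _ (hT i)) (y⟦(1 : ℤ)⟧') (by
        rw [← cancel_mono e.hom, zero_comp]
        exact hN' i _ hZ)
    obtain ⟨ψ, rfl⟩ := (shiftFunctor C (1 : ℤ)).map_surjective ψ
    refine ⟨-ψ, (shiftFunctor C (1 : ℤ)).map_injective ?_⟩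
    rw [hψ]
    simp
  obtain ⟨g', rfl⟩ : ∃ g' : D.pt⟦(1 : ℤ)⟧ ⟶ Z, g = δ ≫ g' :=
    Triangle.yoneda_exact₃ _ hX g (Cofan.IsColimit.hom_ext hD _ _ fun i =>
      (hY i _ hZ).trans comp_zero.symm)
  obtain ⟨k, hk⟩ := (shiftFunctor C (1 : ℤ)).map_surjective (g' ≫ e.inv)
  choose next hnext using hext
  -- Solves `x i - f i ≫ x (i + 1) = D.inj i ≫ k` recursively from `x 0 = 0`, so that `k` factors
  -- through the telescope.
  let x : ∀ i, Y i ⟶ Z' := fun i => Nat.rec 0 (fun i xi => next i (xi - D.inj i ≫ k)) i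
  have hx (i : ℕ) : f i ≫ x (i + 1) = x i - D.inj i ≫ k := hnext i _
  have hk' : telescope f hD ≫ Cofan.IsColimit.desc hD x = k :=
    Cofan.IsColimit.hom_ext hD _ _ fun i => by
      rw [reassoc_of% inj_telescope f hD, Preadditive.sub_comp, Category.assoc, Cofan.IsColimit.fac,
        Cofan.IsColimit.fac, hx, sub_sub_cancel]
  have hδ : δ ≫ (telescope f hD)⟦(1 : ℤ)⟧' = 0 := comp_distTriang_mor_zero₃₁ _ hX
  rw [← cancel_mono e.inv, Category.assoc, ← hk, ← hk', Functor.map_comp, reassoc_of% hδ,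
    zero_comp, zero_comp]

lemma strongExtensionClosure_le_leftOrthogonal (S : ObjectProperty C) :
    strongExtensionClosure S ≤ S.rightOrthogonal.leftOrthogonal := fun _ hX =>
  hX _ ⟨inferInstance, hocolimsOf_leftOrthogonal_le _⟩ inferInstance
    (isSmashingClass_leftOrthogonal _) (le_leftOrthogonal_rightOrthogonal S)

lemma bigHull_le_strongExtensionClosure (S : ObjectProperty C) :
    bigHull S ≤ strongExtensionClosure S := by
  rintro X ⟨Y, hY, ⟨r⟩⟩ Q hQ hQr hQs hSQ
  exact Q.prop_of_retract r (hQ.2 _ (hocolimsOf_monotone (coproductsOf_le hQs hSQ) _ hY))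

section

variable [HasCoproducts.{v} C] {S : ObjectProperty C}

/-- One step of the approximation of `M` by `S`. -/
lemma HasSmallSkeleton.exists_next (hS : HasSmallSkeleton S) {M X : C} (φ : X ⟶ M) :
    ∃ (Y : C) (f : X ⟶ Y) (φ' : Y ⟶ M), f ≫ φ' = φ ∧ (∃ Z, IsCone f Z ∧ coproductsOf S Z) ∧
      ∀ ⦃Q : C⦄, S (Q⟦(1 : ℤ)⟧) → ∀ x : Q ⟶ X, x ≫ φ = 0 → x ≫ f = 0 := by
  -- Working in `X[1]` makes `A` itself, rather than a translate, the cone of `f`.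
  obtain ⟨A, h, hA, hφ, hfac⟩ := hS.exists_precover (φ⟦(1 : ℤ)⟧')
  obtain ⟨Y, f, g, hT⟩ := distinguished_cocone_triangle₂ h
  obtain ⟨φ', hφ', -⟩ := complete_distinguished_triangle_morphism₂ _ _ hT
    (contractible_distinguished M) φ 0 (hφ.trans zero_comp.symm)
  refine ⟨Y, f, φ', hφ'.trans (Category.comp_id φ), ⟨A, ⟨g, h, hT⟩, hA⟩, fun Q hQ x hx => ?_⟩
  obtain ⟨s, hs⟩ := hfac hQ (x⟦(1 : ℤ)⟧') (by rw [← Functor.map_comp, hx, Functor.map_zero])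
  have hf : h ≫ f⟦(1 : ℤ)⟧' = 0 := comp_distTriang_mor_zero₃₁ _ hT
  apply eq_zero_of_shift_map_eq_zero 1
  rw [Functor.map_comp, hs, Category.assoc, hf, comp_zero]

variable [S.IsClosedUnderIsomorphisms]

lemma exists_distTriang_hocolimsOf (hS : HasSmallSkeleton S) (hS' : IsCountablyPerfect S)
    (hSs : ∀ Q, S Q → S (Q⟦(-1 : ℤ)⟧)) (M : C) :
    ∃ (A B : C) (a : A ⟶ M) (b : M ⟶ B) (d : B ⟶ A⟦(1 : ℤ)⟧),
      Triangle.mk a b d ∈ distTriang C ∧ hocolimsOf (coproductsOf S) A ∧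
        S.rightOrthogonal B := by
  have : HasCountableCoproducts C := hasCountableCoproducts_of_hasCoproducts C
  have : HasColimitsOfShape (Discrete ℕ) C := HasCountableCoproducts.out ℕ
  -- The kernel of the zero map is everything, so this covers all morphisms from `S` to `M`.
  obtain ⟨Y₀, φ₀, hY₀, -, hφ₀⟩ := hS.exists_precover (0 : M ⟶ M)
  choose! Y f φ hf hc hk using fun X : Over M => hS.exists_next X.hom
  let E : ℕ → Over M := fun n => Nat.rec (Over.mk φ₀) (fun _ X => Over.mk (φ X)) n
  let f' (n : ℕ) : (E n).left ⟶ (E (n + 1)).left := f (E n)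
  have hf' (n : ℕ) : f' n ≫ (E (n + 1)).hom = (E n).hom := hf (E n)
  have hsurj (n : ℕ) ⦃Q : C⦄ (hQ : S Q) (y : Q ⟶ M) : ∃ x : Q ⟶ (E n).left, x ≫ (E n).hom = y := by
    induction n with
    | zero =>
      obtain ⟨s, hs⟩ := hφ₀ hQ y comp_zero
      exact ⟨s, hs.symm⟩
    | succ n hn =>
      obtain ⟨x, hx⟩ := hn
      exact ⟨x ≫ f' n, by rw [Category.assoc, hf', hx]⟩
  obtain ⟨A, B, a, b, d, hT, hA, hB⟩ := exists_decomposition_of_approximations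
    (φ := fun n => (E n).hom) hS' hSs hf' hsurj (fun n => hk (E n))
  exact ⟨A, B, a, b, d, hT, ⟨_, f', hY₀, fun n => hc (E n), hA⟩, hB⟩

/-- The map from `X` to the cone of its approximation is zero, so `X` splits off the approximation.
-/
lemma leftOrthogonal_rightOrthogonal_le_bigHull (hS : HasSmallSkeleton S)
    (hS' : IsCountablyPerfect S) (hSs : ∀ Q, S Q → S (Q⟦(-1 : ℤ)⟧)) :
    S.rightOrthogonal.leftOrthogonal ≤ bigHull S := by
  intro X hX
  obtain ⟨A, B, a, b, d, hT, hA, hB⟩ := exists_distTriang_hocolimsOf hS hS' hSs X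
  obtain ⟨s, hs⟩ : ∃ s : X ⟶ A, 𝟙 X = s ≫ a :=
    Triangle.coyoneda_exact₂ _ hT (𝟙 X) ((Category.id_comp b).trans (hX b hB))
  exact ⟨A, hA, ⟨⟨s, a, hs.symm⟩⟩⟩

lemma bigHull_eq_leftOrthogonal (hS : HasSmallSkeleton S)
    (hS' : IsCountablyPerfect S) (hSs : ∀ Q, S Q → S (Q⟦(-1 : ℤ)⟧)) :
    bigHull S = S.rightOrthogonal.leftOrthogonal :=
  le_antisymm
    ((bigHull_le_strongExtensionClosure S).trans (strongExtensionClosure_le_leftOrthogonal S))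
    (leftOrthogonal_rightOrthogonal_le_bigHull hS hS' hSs)

lemma bigHull_eq_strongExtensionClosure (hS : HasSmallSkeleton S)
    (hS' : IsCountablyPerfect S) (hSs : ∀ Q, S Q → S (Q⟦(-1 : ℤ)⟧)) :
    bigHull S = strongExtensionClosure S :=
  le_antisymm (bigHull_le_strongExtensionClosure S)
    ((strongExtensionClosure_le_leftOrthogonal S).trans
      (leftOrthogonal_rightOrthogonal_le_bigHull hS hS' hSs))

end

end Triangulated

/-! ### Calculus of translates and the weight structure -/

section Shift

variable {C : Type u} [Category.{v} C] [HasShift C ℤ]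

instance (S : ObjectProperty C) [S.IsStableUnderRetracts] (i : ℤ) :
    (translate S i).IsStableUnderRetracts where
  of_retract r hY := by
    have h : i + (-i) = 0 := add_neg_cancel i
    rw [translate_iff_of_add_eq_zero S h] at hY ⊢
    exact S.prop_of_retract (r.map (shiftFunctor C (-i))) hY

lemma translate_eq_inverseImage (S : ObjectProperty C) [S.IsClosedUnderIsomorphisms]
    {i j : ℤ} (h : i + j = 0) : translate S i = S.inverseImage (shiftFunctor C j) := by
  ext X
  exact translate_iff_of_add_eq_zero S h X

lemma translate_shift_iff (S : ObjectProperty C) [S.IsClosedUnderIsomorphisms]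
    {i j k : ℤ} (h : k + j = i) (X : C) : translate S i (X⟦j⟧) ↔ translate S k X := by
  rw [translate_iff_of_add_eq_zero S (add_neg_cancel i),
    translate_iff_of_add_eq_zero S (add_neg_cancel k)]
  exact S.prop_iff_of_iso ((shiftFunctorAdd' C j (-i) (-k) (by omega)).app X).symm

lemma translate_zero (S : ObjectProperty C) [S.IsClosedUnderIsomorphisms] :
    translate S 0 = S := by
  ext X
  rw [translate_iff_of_add_eq_zero S (add_zero 0)]
  exact S.prop_iff_of_iso ((shiftFunctorZero C ℤ).app X)

lemma translate_translate (S : ObjectProperty C) [S.IsClosedUnderIsomorphisms]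
    {i j k : ℤ} (h : i + j = k) : translate (translate S i) j = translate S k := by
  ext X
  rw [translate_iff_of_add_eq_zero _ (add_neg_cancel j), translate_shift_iff S (k := k) (by omega)]

lemma translate_monotone {S T : ObjectProperty C} (h : S ≤ T) (i : ℤ) :
    translate S i ≤ translate T i := fun _ ⟨Y, hY, e⟩ => ⟨Y, h _ hY, e⟩

lemma translates_shift {P : ObjectProperty C} {I : Set ℤ} {j : ℤ} (hI : ∀ i ∈ I, i + j ∈ I)
    (X : C) (hX : translates P I X) : translates P I (X⟦j⟧) := by
  obtain ⟨i, hi, Y, hY, ⟨e⟩⟩ := hX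
  exact ⟨i + j, hI i hi, Y, hY,
    ⟨(shiftFunctor C j).mapIso e ≪≫ ((shiftFunctorAdd C i j).app Y).symm⟩⟩

lemma le_translates {P : ObjectProperty C} {I : Set ℤ} (h : 0 ∈ I) : P ≤ translates P I :=
  fun X hX => ⟨0, h, X, hX, ⟨((shiftFunctorZero C ℤ).app X).symm⟩⟩

variable [Preadditive C] [∀ n : ℤ, (shiftFunctor C n).Additive]

lemma leftOrthogonal_translate (T : ObjectProperty C) (i : ℤ) :
    (translate T i).leftOrthogonal = translate T.leftOrthogonal i := by
  ext X
  rw [translate_iff_of_add_eq_zero _ (add_neg_cancel i)]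
  constructor
  · intro hX Z f hZ
    apply eq_zero_of_shift_map_eq_zero i
    rw [← cancel_epi (shiftNegShift X i).inv, comp_zero]
    exact hX _ ⟨Z, hZ, ⟨Iso.refl _⟩⟩
  · rintro hX Y f ⟨Z, hZ, ⟨e⟩⟩
    obtain ⟨x, hx⟩ := exists_eq_comp_map_shift i (f ≫ e.hom)
    rw [← cancel_mono e.hom, hx, hX x hZ, Functor.map_zero, comp_zero, zero_comp]

lemma rightOrthogonal_translate (S : ObjectProperty C) (i : ℤ) :
    (translate S i).rightOrthogonal = translate S.rightOrthogonal i := by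
  ext Y
  rw [translate_iff_of_add_eq_zero _ (add_neg_cancel i)]
  constructor
  · intro hY Q f hQ
    apply eq_zero_of_shift_map_eq_zero i
    rw [← cancel_mono (shiftNegShift Y i).hom, zero_comp]
    exact hY _ ⟨Q, hQ, ⟨Iso.refl _⟩⟩
  · rintro hY X f ⟨Q, hQ, ⟨e⟩⟩
    obtain ⟨x, hx⟩ := (shiftFunctor C i).map_surjective (e.inv ≫ f ≫ (shiftNegShift Y i).inv)
    rw [hY x hQ, Functor.map_zero] at hx
    rw [← cancel_epi e.inv, ← cancel_mono (shiftNegShift Y i).inv, Category.assoc, ← hx,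
      comp_zero]
    exact zero_comp.symm

lemma rightOrthogonal_translates_iff (P : ObjectProperty C) (I : Set ℤ) (Y : C) :
    (translates P I).rightOrthogonal Y ↔ ∀ i ∈ I, translate P.rightOrthogonal i Y := by
  simp only [← rightOrthogonal_translate]
  exact ⟨fun h i hi Q f hQ => h f ⟨i, hi, hQ⟩, fun h Q f ⟨i, hi, hQ⟩ => h i hi f hQ⟩

lemma rightOrthogonal_shift_one {S : ObjectProperty C} (hS : ∀ Q, S Q → S (Q⟦(-1 : ℤ)⟧))
    (Y : C) (hY : S.rightOrthogonal Y) : S.rightOrthogonal (Y⟦(1 : ℤ)⟧) := by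
  intro Q f hQ
  obtain ⟨x, rfl⟩ := exists_eq_comp_map_shift 1 f
  rw [hY x (hS Q hQ), Functor.map_zero, comp_zero]

end Shift

section WeightStructure

variable {C : Type u} [Category.{v} C] [HasZeroObject C] [HasShift C ℤ] [Preadditive C]
  [∀ n : ℤ, (shiftFunctor C n).Additive] [Pretriangulated C] [HasCoproducts.{v} C]

theorem isWeightStructure_bigHull {S : ObjectProperty C} [S.IsClosedUnderIsomorphisms]
    (hS : HasSmallSkeleton S) (hS' : IsCountablyPerfect S)
    (hSs : ∀ Q, S Q → S (Q⟦(-1 : ℤ)⟧)) :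
    IsWeightStructure (bigHull S) (translate S.rightOrthogonal (-1)) := by
  have hR : translate (translate S.rightOrthogonal (-1)) 1 = S.rightOrthogonal := by
    rw [translate_translate _ (neg_add_cancel 1), translate_zero]
  have hT : S.rightOrthogonal ≤ translate S.rightOrthogonal (-1) := fun Y hY => by
    rw [translate_iff_of_add_eq_zero _ (neg_add_cancel 1)]
    exact rightOrthogonal_shift_one hSs Y hY
  rw [bigHull_eq_leftOrthogonal hS hS' hSs]
  refine ⟨inferInstance, inferInstance, ?_, ?_, ?_, fun M => ?_⟩
  · rw [← leftOrthogonal_translate]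
    intro X hX Y f hY
    refine hX f ?_
    rw [← hR]
    exact translate_monotone hT 1 _ hY
  · rw [hR]
    exact hT
  · rw [hR]
    exact fun X Y hX hY f => hX f hY
  · obtain ⟨A, B, a, b, d, h, hA, hB⟩ := exists_distTriang_hocolimsOf hS hS' hSs M
    refine ⟨A, B, a, b, d, h, ?_, by rwa [hR]⟩
    rw [← bigHull_eq_leftOrthogonal hS hS' hSs]
    exact ObjectProperty.le_retractClosure _ _ hA

end WeightStructure

/-! ### Localizing classes and the Eilenberg swindle -/

section Localizing

variable {C : Type u} [Category.{v} C] [HasZeroObject C] [HasShift C ℤ] [Preadditive C]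
  [∀ n : ℤ, (shiftFunctor C n).Additive] [Pretriangulated C]

lemma isLocalizing_localizingClosure (P : ObjectProperty C) :
    IsLocalizing (localizingClosure P) where
  triangulated := inferInstance
  strict := ⟨fun e hX Q hQ h => by
    have := hQ.strict
    exact Q.prop_of_iso e (hX Q hQ h)⟩
  coproducts J := ⟨fun X hX Q hQ h => (hQ.coproducts J).colimitsOfShape_le _
    (ObjectProperty.colimitsOfShape_monotone _ (fun Y hY => hY Q hQ h) _ hX)⟩

lemma le_localizingClosure (P : ObjectProperty C) : P ≤ localizingClosure P :=
  fun _ hX _ _ h => h _ hX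

instance (P : ObjectProperty C) : (localizingClosure P).IsClosedUnderIsomorphisms :=
  (isLocalizing_localizingClosure P).strict

lemma translates_le_localizingClosure (P : ObjectProperty C) (I : Set ℤ) :
    translates P I ≤ localizingClosure P := by
  rintro X ⟨i, -, Y, hY, ⟨e⟩⟩
  exact (localizingClosure P).prop_of_iso e.symm
    ((localizingClosure P).le_shift i _ (le_localizingClosure P _ hY))

lemma IsLocalizing.isClosedUnderColimitsOfShape_nat {Q : ObjectProperty C} (hQ : IsLocalizing Q) :
    Q.IsClosedUnderColimitsOfShape (Discrete ℕ) := by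
  have := hQ.coproducts (ULift.{v} ℕ)
  exact .of_equivalence (Discrete.equivalence Equiv.ulift)

lemma IsLocalizing.isStronglyExtensionClosed {Q : ObjectProperty C} (hQ : IsLocalizing Q) :
    IsStronglyExtensionClosed Q := by
  have := hQ.triangulated
  have := hQ.strict
  have := hQ.isClosedUnderColimitsOfShape_nat
  refine ⟨inferInstance, ?_⟩
  rintro X ⟨Y, f, h₀, hf, D, hD, p, δ, hX⟩
  choose N hN hN' using hf
  choose a b hT using hN
  have hY (i : ℕ) : Q (Y i) := by
    induction i with
    | zero => exact h₀
    | succ i hi => exact Q.ext_of_isTriangulatedClosed₂ _ (hT i) hi (hN' i)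
  have hD' : Q D.pt := Q.prop_of_isColimit hD fun j => hY j.as
  exact Q.ext_of_isTriangulatedClosed₃ _ hX hD' hD'

end Localizing

section Swindle

variable {C : Type u} [Category.{v} C] [Preadditive C] [HasColimitsOfShape (Discrete ℕ) C]
  [HasBinaryBiproducts C]

/-- The Eilenberg swindle: adding a retract of `Z` to the countable copower of `Z` does not
change the latter. -/
lemma nonempty_biprod_iso_of_retract {X Z : C} (h : Retract X Z) :
    Nonempty (X ⊞ (∐ fun _ : ℕ => Z) ≅ ∐ fun _ : ℕ => Z) := by
  let j : ℕ → (Z ⟶ ∐ fun _ : ℕ => Z) := fun n => Sigma.ι (fun _ : ℕ => Z) n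
  let e : Z ⟶ Z := h.r ≫ h.i
  have hie : h.i ≫ e = h.i := by simp [e]
  have her : e ≫ h.r = h.r := by simp [e]
  have hee : e ≫ e = e := by simp [e]
  -- Shifts the image of `e` by one place and fixes that of `𝟙 - e`, leaving free the copy of `X` in
  -- place 0. Idempotents are used because `𝟙 - e` is not assumed to split.
  let s : (∐ fun _ : ℕ => Z) ⟶ ∐ fun _ : ℕ => Z :=
    Sigma.desc fun n => e ≫ j (n + 1) + (𝟙 Z - e) ≫ j n
  let p : (∐ fun _ : ℕ => Z) ⟶ X := Sigma.desc fun n => if n = 0 then h.r else 0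
  let q : (∐ fun _ : ℕ => Z) ⟶ ∐ fun _ : ℕ => Z :=
    Sigma.desc fun n => (𝟙 Z - e) ≫ j n + if n = 0 then 0 else e ≫ j (n - 1)
  have hs (n : ℕ) : j n ≫ s = e ≫ j (n + 1) + (𝟙 Z - e) ≫ j n := by simp [j, s]
  have hp (n : ℕ) : j n ≫ p = if n = 0 then h.r else 0 := by simp [j, p]
  have hq (n : ℕ) : j n ≫ q = (𝟙 Z - e) ≫ j n + if n = 0 then 0 else e ≫ j (n - 1) := by
    simp [j, q]
  have h1 : p ≫ h.i ≫ j 0 + q ≫ s = 𝟙 _ := Sigma.hom_ext _ _ fun n => by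
    change j n ≫ _ = j n ≫ _
    rw [Preadditive.comp_add, reassoc_of% hp, reassoc_of% hq]
    cases n with
    | zero => simp [hs, Preadditive.sub_comp, Preadditive.comp_add, Preadditive.comp_sub, e]
    | succ n => simp [hs, Preadditive.add_comp, Preadditive.sub_comp, Preadditive.comp_add,
        Preadditive.comp_sub, reassoc_of% hee]
  have h2 : s ≫ p = 0 := Sigma.hom_ext _ _ fun n => by
    change j n ≫ _ = j n ≫ _
    rw [reassoc_of% hs]
    cases n <;> simp [hp, Preadditive.add_comp, Preadditive.sub_comp, her]
  have h3 : s ≫ q = 𝟙 _ := Sigma.hom_ext _ _ fun n => by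
    change j n ≫ _ = j n ≫ _
    rw [reassoc_of% hs]
    cases n <;> simp [hq, Preadditive.add_comp, Preadditive.sub_comp, Preadditive.comp_add,
        Preadditive.comp_sub, reassoc_of% hee]
  have h4 : h.i ≫ j 0 ≫ p = 𝟙 X := by simp [hp]
  have h5 : h.i ≫ j 0 ≫ q = 0 := by simp [hq, Preadditive.sub_comp, Preadditive.comp_sub,
    reassoc_of% hie]
  refine ⟨⟨biprod.desc (h.i ≫ j 0) s, biprod.lift p q, ?_, ?_⟩⟩
  · apply biprod.hom_ext' <;> apply biprod.hom_ext <;> simp [h2, h3, h4, h5]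
  · rw [biprod.lift_desc, h1]

end Swindle

section LocalizingRetract

variable {C : Type u} [Category.{v} C] [HasZeroObject C] [HasShift C ℤ] [Preadditive C]
  [∀ n : ℤ, (shiftFunctor C n).Additive] [Pretriangulated C] [HasCoproducts.{v} C]

/-- By the swindle, `X` is the first term of a split triangle whose other two terms are both
isomorphic to the countable copower of `Z`. -/
lemma IsLocalizing.isStableUnderRetracts {Q : ObjectProperty C} (hQ : IsLocalizing Q) :
    Q.IsStableUnderRetracts where
  of_retract {X Z} r hZ := by
    have : HasCountableCoproducts C := hasCountableCoproducts_of_hasCoproducts C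
    have : HasColimitsOfShape (Discrete ℕ) C := HasCountableCoproducts.out ℕ
    have := hQ.triangulated
    have := hQ.strict
    have := hQ.isClosedUnderColimitsOfShape_nat
    obtain ⟨e⟩ := nonempty_biprod_iso_of_retract r
    have hZ' : Q (∐ fun _ : ℕ => Z) := Q.prop_colimit _ fun _ => hZ
    exact Q.ext_of_isTriangulatedClosed₁ _ (binaryBiproductTriangle_distinguished X _)
      (Q.prop_of_iso e.symm hZ') hZ'

lemma bigHull_translates_le_localizingClosure (P : ObjectProperty C) (I : Set ℤ) :
    bigHull (translates P I) ≤ localizingClosure P := fun X hX =>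
  have hQ := isLocalizing_localizingClosure P
  bigHull_le_strongExtensionClosure _ X hX _ hQ.isStronglyExtensionClosed
    hQ.isStableUnderRetracts hQ.coproducts (translates_le_localizingClosure P I)

end LocalizingRetract

/-! ### Restriction to a triangulated subcategory -/

section Subcategory

lemma strictMap_inverseImage_ι {C : Type u} [Category.{v} C] {Q L : ObjectProperty C} (h : L ≤ Q) :
    (L.inverseImage Q.ι).strictMap Q.ι = L := by
  ext X
  rw [ObjectProperty.strictMap_iff]
  exact ⟨fun ⟨X, hX, e⟩ => e ▸ hX, fun hX => ⟨⟨X, h _ hX⟩, hX, rfl⟩⟩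

variable {C : Type u} [Category.{v} C] [HasZeroObject C] [HasShift C ℤ] [Preadditive C]
  [∀ n : ℤ, (shiftFunctor C n).Additive] [Pretriangulated C]
  (Q : ObjectProperty C) [Q.IsTriangulated]

lemma translate_inverseImage_ι (R : ObjectProperty C) [R.IsClosedUnderIsomorphisms]
    (i : ℤ) :
    translate (R.inverseImage Q.ι) i = (translate R i).inverseImage Q.ι := by
  ext X
  rw [translate_iff_of_add_eq_zero _ (add_neg_cancel i), ObjectProperty.prop_inverseImage_iff,
    ObjectProperty.prop_inverseImage_iff, translate_iff_of_add_eq_zero _ (add_neg_cancel i)]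
  exact R.prop_iff_of_iso ((Q.ι.commShiftIso (-i)).app X)

lemma rightOrthogonal_inverseImage_ι {P : ObjectProperty C} (h : P ≤ Q) :
    (P.inverseImage Q.ι).rightOrthogonal = P.rightOrthogonal.inverseImage Q.ι := by
  ext Y
  constructor
  · intro hY X f hX
    have := hY (X := ⟨X, h _ hX⟩) (Q.fullyFaithfulι.preimage f) hX
    simpa using Q.ι.congr_map this
  · intro hY X f hX
    exact Q.ι.map_injective ((hY (Q.ι.map f) hX).trans (Q.ι.map_zero _ _).symm)

instance (R : ObjectProperty C) [R.IsStableUnderRetracts] :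
    (R.inverseImage Q.ι).IsStableUnderRetracts where
  of_retract r hY := R.prop_of_retract (r.map Q.ι) hY

/-- A weight structure restricts to a triangulated subcategory that contains its left class. -/
lemma IsWeightStructure.inverseImage_ι [Q.IsClosedUnderIsomorphisms] {L R : ObjectProperty C}
    (hw : IsWeightStructure L R) (hLQ : L ≤ Q) :
    IsWeightStructure (L.inverseImage Q.ι) (R.inverseImage Q.ι) := by
  have := hw.retract_le
  have := hw.retract_ge
  refine ⟨inferInstance, inferInstance, ?_, ?_, ?_, fun M => ?_⟩
  · rw [translate_inverseImage_ι]
    exact fun X hX => hw.le_shift _ hX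
  · rw [translate_inverseImage_ι]
    exact fun X hX => hw.shift_ge _ hX
  · rw [translate_inverseImage_ι]
    exact fun X Y hX hY f =>
      Q.ι.map_injective ((hw.orthogonal hX hY (Q.ι.map f)).trans (Q.ι.map_zero _ _).symm)
  · obtain ⟨A, B, a, b, d, hT, hA, hB⟩ := hw.exists_decomposition (Q.ι.obj M)
    have hAQ : Q A := hLQ _ hA
    have hBQ : Q B := Q.ext_of_isTriangulatedClosed₃ _ hT hAQ M.2
    let A' : Q.FullSubcategory := ⟨A, hAQ⟩
    let B' : Q.FullSubcategory := ⟨B, hBQ⟩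
    let d' : Q.ι.obj B' ⟶ (Q.ι ⋙ shiftFunctor C (1 : ℤ)).obj A' := d
    refine ⟨A', B', Q.fullyFaithfulι.preimage (X := A') a, Q.fullyFaithfulι.preimage (Y := B') b,
      Q.fullyFaithfulι.preimage (X := B') (d' ≫ (Q.ι.commShiftIso (1 : ℤ)).inv.app A'), ?_, hA, ?_⟩
    · exact isomorphic_distinguished _ hT _
        (Triangle.isoMk _ _ (Iso.refl _) (Iso.refl _) (Iso.refl _)
          (by exact (Category.comp_id a).trans (Category.id_comp a).symm)
          (by exact (Category.comp_id b).trans (Category.id_comp b).symm)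
          (by
            have h : (d' ≫ (Q.ι.commShiftIso (1 : ℤ)).inv.app A') ≫
                (Q.ι.commShiftIso (1 : ℤ)).hom.app A' = d' := by
              rw [Category.assoc, Iso.inv_hom_id_app, Category.comp_id]
            exact (congrArg₂ (· ≫ ·) h ((shiftFunctor C (1 : ℤ)).map_id A)).trans
              ((Category.comp_id d).trans (Category.id_comp d).symm)))
    · rw [translate_inverseImage_ι]
      exact hB

end Subcategory

/-! ### Generating the heart -/

section Heart

variable {C : Type u} [Category.{v} C] [HasZeroObject C] [HasShift C ℤ] [Preadditive C]
  [∀ n : ℤ, (shiftFunctor C n).Additive] [Pretriangulated C]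

/-- The weak reflection into the heart of an object of the left class. -/
lemma IsWeightStructure.exists_heart_reflection {L R : ObjectProperty C}
    (hw : IsWeightStructure L R) [L.IsTriangulatedClosed₂] {Q : C} (hQ : L Q) :
    ∃ (H : C) (u : Q ⟶ H), (L ⊓ R) H ∧ ∀ M, R M → ∀ f : Q ⟶ M, ∃ g : H ⟶ M, u ≫ g = f := by
  have := hw.retract_le
  have := hw.retract_ge
  -- Decomposing `Q[1]` and shifting back puts `B[-1]` in `R`, not merely `B` in `R[1]`; being an
  -- extension of `A` by `Q`, it also lies in `L`.
  obtain ⟨A, B, a, b, d, hT, hA, hB⟩ := hw.exists_decomposition (Q⟦(1 : ℤ)⟧)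
  have hT' := Triangle.shift_distinguished _ hT (-1)
  let s : Q⟦(1 : ℤ)⟧⟦(-1 : ℤ)⟧ ≅ Q := shiftShiftNeg Q (1 : ℤ)
  have hRB : R (B⟦(-1 : ℤ)⟧) := (translate_iff_of_add_eq_zero R (add_neg_cancel 1) B).1 hB
  have hLB : L (B⟦(-1 : ℤ)⟧) := L.ext_of_isTriangulatedClosed₂ _ (rot_of_distTriang _ hT')
    (L.prop_of_iso s.symm hQ) (L.prop_of_iso (shiftNegShift A (1 : ℤ)).symm hA)
  let m : Q⟦(1 : ℤ)⟧⟦(-1 : ℤ)⟧ ⟶ B⟦(-1 : ℤ)⟧ :=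
    ((Triangle.shiftFunctor C (-1)).obj (Triangle.mk a b d)).mor₂
  refine ⟨B⟦(-1 : ℤ)⟧, s.inv ≫ m,
    ⟨hLB, hRB⟩, fun M hM f => ?_⟩
  have h0 (g : A⟦(-1 : ℤ)⟧ ⟶ M) : g = 0 := by
    apply eq_zero_of_shift_map_eq_zero 1
    rw [← cancel_epi (shiftNegShift A (1 : ℤ)).inv, comp_zero]
    exact hw.orthogonal hA ⟨M, hM, ⟨Iso.refl _⟩⟩ _
  obtain ⟨g, hg⟩ : ∃ g : B⟦(-1 : ℤ)⟧ ⟶ M, s.hom ≫ f = m ≫ g :=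
    Triangle.yoneda_exact₂ _ hT' (s.hom ≫ f) (h0 _)
  exact ⟨g, by rw [Category.assoc, ← hg, Iso.inv_hom_id_assoc]⟩

/-- If coproducts exist in the heart, then the weak reflections of the objects of a small class
generating the weight structure generate the heart. -/
lemma IsWeightStructure.exists_heart_generator [HasCoproducts.{v} C]
    {L R P : ObjectProperty C} (hw : IsWeightStructure L R) [ObjectProperty.Small.{v} P]
    [L.IsTriangulatedClosed₂] (hL : IsSmashingClass L) (hR : IsSmashingClass R)
    (hPL : P ≤ L) (hgen : ∀ K, R K → (∀ ⦃Q⦄, P Q → ∀ y : Q ⟶ K, y = 0) → translate R 1 K)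
    [R.IsTriangulatedClosed₂] :
    ∃ G : C, (L ⊓ R) G ∧ ∀ M : C, (L ⊓ R) M →
      ∃ (J : Type v) (D : Cofan fun _ : J => G),
        Nonempty (IsColimit D) ∧ Nonempty (Retract M D.pt) := by
  have := hw.retract_le
  have := hw.retract_ge
  let q (k : Shrink.{v} (Subtype P)) : C := ((equivShrink (Subtype P)).symm k).1
  have hq (k) : P (q k) := ((equivShrink (Subtype P)).symm k).2
  choose H u hH hu using fun k => hw.exists_heart_reflection (hPL _ (hq k))
  have hsigma {J : Type v} (X : J → C) (hX : ∀ j, (L ⊓ R) (X j)) : (L ⊓ R) (∐ X) :=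
    ⟨coproductsOf_le hL le_rfl _ (coproductsOf_sigma X fun j => (hX j).1),
      coproductsOf_le hR le_rfl _ (coproductsOf_sigma X fun j => (hX j).2)⟩
  refine ⟨∐ H, hsigma _ hH, fun M hM => ?_⟩
  let J := Σ k, (q k ⟶ M)
  choose g hg using fun j : J => hu j.1 M hM.2 j.2
  let N := ∐ fun j : J => H j.1
  have hN : (L ⊓ R) N := hsigma _ fun j => hH j.1
  obtain ⟨K, b, d, hT⟩ := distinguished_cocone_triangle (Sigma.desc g : N ⟶ M)
  have hN1 : translate R 1 (N⟦(1 : ℤ)⟧) := ⟨N, hN.2, ⟨Iso.refl _⟩⟩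
  have hK : R K := R.ext_of_isTriangulatedClosed₂ _ (rot_of_distTriang _ hT) hM.2
    (hw.shift_ge _ hN1)
  -- Each `y` lifts to `M` by orthogonality, and every morphism from `P` to `M` factors through a
  -- reflection, hence through `N`; so `y = 0`.
  have hK1 : translate R 1 K := hgen K hK fun Q hQ y => by
    obtain ⟨z, rfl⟩ : ∃ z : Q ⟶ M, y = z ≫ b :=
      Triangle.coyoneda_exact₃ _ hT y (hw.orthogonal (hPL _ hQ) hN1 _)
    obtain ⟨k, rfl⟩ : ∃ k, q k = Q := ⟨equivShrink _ ⟨Q, hQ⟩, by simp [q]⟩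
    have hb : Sigma.desc g ≫ b = 0 := comp_distTriang_mor_zero₁₂ _ hT
    have hz : u k ≫ Sigma.ι (fun j : J => H j.1) ⟨k, z⟩ ≫ Sigma.desc g = z := by
      rw [Sigma.ι_desc]
      exact hg ⟨k, z⟩
    rw [← hz, Category.assoc, Category.assoc, hb, comp_zero, comp_zero]
  obtain ⟨s, hs⟩ : ∃ s : M ⟶ N, 𝟙 M = s ≫ Sigma.desc g :=
    Triangle.coyoneda_exact₂ _ hT (𝟙 M)
      ((Category.id_comp b).trans (hw.orthogonal hM.1 hK1 b))
  classical
  -- Each `H k` is a summand of `∐ H`, so `N` is a retract of a copower of the single object `∐ H`.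
  let i : N ⟶ ∐ fun _ : J => ∐ H := Limits.Sigma.map fun j => Sigma.ι H j.1
  let p : (∐ fun _ : J => ∐ H) ⟶ N := Limits.Sigma.map fun j => Limits.Sigma.π H j.1
  have hip : i ≫ p = 𝟙 N := Sigma.hom_ext _ _ fun j => by simp [i, p, N]
  refine ⟨J, Cofan.mk _ (Sigma.ι _), ⟨coproductIsCoproduct _⟩,
    ⟨⟨s ≫ i, p ≫ Sigma.desc g, ?_⟩⟩⟩
  rw [Category.assoc, reassoc_of% hip, ← hs]

end Heart

/-! ### Assembly of the three parts -/

section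

variable {C : Type u} [Category.{v} C] [HasShift C ℤ] [Preadditive C]

lemma isSmashingClass_translate_rightOrthogonal {S : ObjectProperty C} (hS : IsPerfect S)
    (i : ℤ) : IsSmashingClass (translate S.rightOrthogonal i) := fun J => by
  have := hS J
  have := isClosedUnderColimitsOfShape_rightOrthogonal S J
  rw [translate_eq_inverseImage _ (add_neg_cancel i)]
  infer_instance

lemma isCountablySmashingClass_translate_rightOrthogonal {S : ObjectProperty C}
    (hS : IsCountablyPerfect S) (i : ℤ) :
    IsCountablySmashingClass (translate S.rightOrthogonal i) := fun J _ => by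
  have := hS J
  have := isClosedUnderColimitsOfShape_rightOrthogonal S J
  rw [translate_eq_inverseImage _ (add_neg_cancel i)]
  infer_instance

lemma rightOrthogonal_translates_antitone (P : ObjectProperty C) {I J : Set ℤ} (h : I ⊆ J) :
    (translates P J).rightOrthogonal ≤ (translates P I).rightOrthogonal :=
  fun _ hX _ f ⟨i, hi, hQ⟩ => hX f ⟨i, h hi, hQ⟩

variable [∀ n : ℤ, (shiftFunctor C n).Additive]

lemma translate_rightOrthogonal_translates_Iic (P : ObjectProperty C) :
    translate (translates P (Set.Iic 0)).rightOrthogonal (-1) =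
      (translates P (Set.Iio 0)).rightOrthogonal := by
  ext X
  rw [translate_iff_of_add_eq_zero _ (neg_add_cancel 1), rightOrthogonal_translates_iff,
    rightOrthogonal_translates_iff]
  constructor
  · intro h i hi
    exact (translate_shift_iff _ rfl X).1 (h (i + 1) (by simpa using hi))
  · intro h i hi
    exact (translate_shift_iff _ (sub_add_cancel i 1) X).2
      (h (i - 1) (by simp only [Set.mem_Iic, Set.mem_Iio] at hi ⊢; omega))

lemma rightOrthogonal_translates_univ_shift (P : ObjectProperty C) (j : ℤ) (X : C)
    (hX : (translates P Set.univ).rightOrthogonal X) :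
    (translates P Set.univ).rightOrthogonal (X⟦j⟧) := by
  rw [rightOrthogonal_translates_iff] at hX ⊢
  exact fun i _ => (translate_shift_iff _ (sub_add_cancel i j) X).2 (hX _ trivial)

end

section

variable {C : Type u} [Category.{v} C] [HasZeroObject C] [HasShift C ℤ] [Preadditive C]
  [∀ n : ℤ, (shiftFunctor C n).Additive] [Pretriangulated C]

/-- Approximating by all translates of `P` puts `A` in the localizing subcategory and `B` in the
full orthogonal. As that orthogonal is shift-stable, `A` is an extension of `M` by `B[-1]` and
inherits the orthogonality of `M`. -/
lemma rightOrthogonal_Iio_eq_extensionProduct [HasCoproducts.{v} C] (P : ObjectProperty C)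
    [ObjectProperty.Small.{v} P] (hP : IsCountablyPerfect P) :
    (translates P (Set.Iio 0)).rightOrthogonal =
      ObjectProperty.extensionProduct
        ((translates P (Set.Iio 0)).rightOrthogonal ⊓ localizingClosure P)
        (translates P Set.univ).rightOrthogonal := by
  have hO := rightOrthogonal_translates_antitone P (Set.subset_univ (Set.Iio (0 : ℤ)))
  refine le_antisymm (fun M hM => ?_)
    (ObjectProperty.extensionProduct_le_of_isTriangulatedClosed₂ inf_le_left hO)
  obtain ⟨A, B, a, b, d, hT, hA, hB⟩ := exists_distTriang_hocolimsOf
    (hasSmallSkeleton_translates P Set.univ) (hP.translates Set.univ)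
    (translates_shift fun _ _ => trivial) M
  refine ⟨A, B, a, b, d, hT, ⟨?_, ?_⟩, hB⟩
  · exact ObjectProperty.ext_of_isTriangulatedClosed₂ _ _ (inv_rot_of_distTriang _ hT)
      (hO _ (rightOrthogonal_translates_univ_shift P (-1) B hB)) hM
  · exact bigHull_translates_le_localizingClosure P Set.univ _
      (ObjectProperty.le_retractClosure _ _ hA)

lemma isGeneratedBy_inverseImage_ι (P Q : ObjectProperty C) [Q.IsTriangulated]
    (h : P ≤ Q) :
    IsGeneratedBy ((translates P (Set.Iio 0)).rightOrthogonal.inverseImage Q.ι)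
      (P.inverseImage Q.ι) := by
  ext X
  rw [rightOrthogonal_translates_iff, ObjectProperty.prop_inverseImage_iff,
    rightOrthogonal_translates_iff]
  simp only [rightOrthogonal_inverseImage_ι Q h, translate_inverseImage_ι,
    ObjectProperty.prop_inverseImage_iff]

end

end PerfWeight

open PerfWeight in
theorem theorem2p3 {C : Type u} [Category.{v} C] [HasZeroObject C] [HasShift C ℤ] [Preadditive C]
    [∀ n : ℤ, (shiftFunctor C n).Additive] [Pretriangulated C] [IsTriangulated C]
    [HasCoproducts.{v} C] (P : ObjectProperty C) [ObjectProperty.Small.{v} P]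
    (hP : IsCountablyPerfect P) (P' L R O : ObjectProperty C)
    (hP' : P' = translates P (Set.Iic 0))
    (hL : L = bigHull P')
    (hR : R = translate P'.rightOrthogonal (-1))
    (hO : O = (translates P Set.univ).rightOrthogonal) :
    -- Part 1
    (IsWeightStructure L R ∧ IsCountablySmashingClass R ∧
      L = strongExtensionClosure P' ∧
      R = (fun X => ∀ i < 0, translate P.rightOrthogonal i X) ∧
      L = translate R.leftOrthogonal 1) ∧
    -- Part 2
    (∃ L' R' : ObjectProperty (localizingClosure P).FullSubcategory,
      IsWeightStructure L' R' ∧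
      IsGeneratedBy R' (P.inverseImage (localizingClosure P).ι) ∧
      L'.strictMap (localizingClosure P).ι = L ∧
      R = ObjectProperty.extensionProduct (R'.strictMap (localizingClosure P).ι) O ∧
      (L' ⊓ R').strictMap (localizingClosure P).ι = L ⊓ R) ∧
    -- Part 3
    (IsPerfect P → IsSmashingClass R ∧
      ∃ G : C, (L ⊓ R) G ∧ ∀ M : C, (L ⊓ R) M →
        ∃ (J : Type v) (D : Cofan fun _ : J => G),
          Nonempty (IsColimit D) ∧ Nonempty (Retract M D.pt)) := by
  have hS := hasSmallSkeleton_translates P (Set.Iic 0)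
  have hSs : ∀ Q, translates P (Set.Iic 0) Q → translates P (Set.Iic 0) (Q⟦(-1 : ℤ)⟧) :=
    translates_shift fun i hi => by simp only [Set.mem_Iic] at hi ⊢; omega
  have hR' := translate_rightOrthogonal_translates_Iic P
  subst hP' hL hR hO
  have hS' := hP.translates (Set.Iic 0)
  have hw := isWeightStructure_bigHull hS hS' hSs
  have hLperp := bigHull_eq_leftOrthogonal hS hS' hSs
  have hLQ := bigHull_translates_le_localizingClosure P (Set.Iic 0)
  refine ⟨⟨hw, isCountablySmashingClass_translate_rightOrthogonal hS' _,
    bigHull_eq_strongExtensionClosure hS hS' hSs, ?_, ?_⟩,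
    ⟨_, _, hw.inverseImage_ι _ hLQ, ?_, strictMap_inverseImage_ι hLQ, ?_,
      strictMap_inverseImage_ι (inf_le_left.trans hLQ)⟩, fun hP₁ => ?_⟩
  · rw [hR']
    ext X
    exact rightOrthogonal_translates_iff P _ X
  · rw [hLperp, leftOrthogonal_translate, PerfWeight.translate_translate _ (neg_add_cancel 1),
      PerfWeight.translate_zero]
  · rw [hR']
    exact isGeneratedBy_inverseImage_ι P _ (le_localizingClosure P)
  · rw [hR']
    refine (rightOrthogonal_Iio_eq_extensionProduct P hP).trans ?_
    congr 1
    rw [← strictMap_inverseImage_ι (Q := localizingClosure P) inf_le_right]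
    congr 1
    ext X
    exact and_iff_left X.2
  · have hsm := isSmashingClass_translate_rightOrthogonal (hP₁.translates (Set.Iic 0)) (-1)
    refine ⟨hsm, ?_⟩
    have : (bigHull (translates P (Set.Iic 0))).IsTriangulatedClosed₂ := by
      rw [hLperp]
      infer_instance
    have : (translate (translates P (Set.Iic 0)).rightOrthogonal
        (-1)).IsTriangulatedClosed₂ := by
      rw [hR']
      infer_instance
    refine hw.exists_heart_generator (P := P) ?_ hsm ?_ ?_
    · rw [hLperp]
      exact isSmashingClass_leftOrthogonal _
    · rw [hLperp]
      exact (le_translates (by simp)).trans (le_leftOrthogonal_rightOrthogonal _)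
    · intro K hK hK0
      rw [PerfWeight.translate_translate _ (neg_add_cancel 1), PerfWeight.translate_zero,
        rightOrthogonal_translates_iff]
      rw [hR', rightOrthogonal_translates_iff] at hK
      intro i hi
      -- `R` and `R[1]` differ only by the orthogonality condition in degree 0, which is the
      -- hypothesis on morphisms from `P`.
      obtain rfl | hi := eq_or_lt_of_le (Set.mem_Iic.1 hi)
      · rw [PerfWeight.translate_zero]
        exact fun Q y hQ => hK0 hQ y
      · exact hK i hi
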